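/- Let $N \ge 2$ and $k \ge 3$ be integers. There exists $\bar\nu \in (0,1)$, depending only on $N$ and $k$, such that the following holds. Let $M>0$ and let $u_1,\dots,u_k \in H^1_{\mathrm{loc}}(\mathbb{R}^N)\cap C(\mathbb{R}^N)$ be nonnegative functions solving, in the weak sense, \[ \Delta u_i = M\, u_i \prod_{\substack{j=1\\ j\neq i}}^k u_j^2 \quad\text{in } \mathbb{R}^N, \qquad i=1,\dots,k, \] that is, $\int_{\mathbb{R}^N} \nabla u_i\cdot\nabla\varphi\,dx = -\int_{\mathbb{R}^N} M u_i \prod_{j\ne i}u_j^2\,\varphi\,dx$ for every $\varphi\in C_c^\infty(\mathbb{R}^N)$ and every $i$. Suppose that, for some constants $C \in \mathbb{R}$ and $\alpha<\bar\nu$, \[ 0\le u_i(x)\le C(1+|x|^\alpha)\qquad\text{for every } x\in\mathbb{R}^N \text{ and } i=1,\dots,k. \] Then at least one component $u_i$ vanishes identically and all the others are constant. -/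

import Mathlib

open MeasureTheory
open scoped ContDiff

/-- Test functions on `ℝ^N`: smooth real functions with compact support. -/
def IsTestFunction {N : ℕ} (φ : EuclideanSpace ℝ (Fin N) → ℝ) : Prop :=
  ContDiff ℝ ∞ φ ∧ HasCompactSupport φ

/-- `f ∈ L²_loc(ℝ^N; F)`: `f` is square integrable on every compact set. -/
def MemL2Loc {N : ℕ} {F : Type*} [NormedAddCommGroup F]
    (f : EuclideanSpace ℝ (Fin N) → F) : Prop :=
  ∀ K : Set (EuclideanSpace ℝ (Fin N)), IsCompact K → MemLp f 2 (volume.restrict K)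

/-- `u ∈ H¹_loc(ℝ^N)` with weak gradient `G`: both `u` and `G` are in `L²_loc`, and
`∫ u ∂_v φ = - ∫ φ (G · v)` for every test function `φ` and every direction `v`. -/
structure MemH1LocWithGradient {N : ℕ} (u : EuclideanSpace ℝ (Fin N) → ℝ)
    (G : EuclideanSpace ℝ (Fin N) → EuclideanSpace ℝ (Fin N)) : Prop where
  memL2Loc : MemL2Loc u
  memL2Loc_gradient : MemL2Loc G
  integral_eq : ∀ φ : EuclideanSpace ℝ (Fin N) → ℝ, IsTestFunction φ →
    ∀ v : EuclideanSpace ℝ (Fin N),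
      ∫ x, u x * fderiv ℝ φ x v = - ∫ x, φ x * inner ℝ (G x) v

/-- `u ∈ H¹_loc(ℝ^N)`. -/
def MemH1Loc {N : ℕ} (u : EuclideanSpace ℝ (Fin N) → ℝ) : Prop :=
  ∃ G : EuclideanSpace ℝ (Fin N) → EuclideanSpace ℝ (Fin N), MemH1LocWithGradient u G

/-- `u ∈ H¹_loc(ℝ^N)` solves `Δ u = f` weakly in `ℝ^N`: for the weak gradient `G` of `u`,
`∫ G · ∇φ = - ∫ f φ` for every test function `φ`. -/
def IsWeakSolutionLaplace {N : ℕ} (u f : EuclideanSpace ℝ (Fin N) → ℝ) : Prop :=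
  ∃ G : EuclideanSpace ℝ (Fin N) → EuclideanSpace ℝ (Fin N), MemH1LocWithGradient u G ∧
    ∀ φ : EuclideanSpace ℝ (Fin N) → ℝ, IsTestFunction φ →
      ∫ x, inner ℝ (G x) (gradient φ x) = - ∫ x, f x * φ x

/-!
The proof only uses averages of the components against a fixed radial kernel; no monotonicity
formula is needed, because the exponent `ν` may be taken small.

*Mean values.* Let `bump x r` be a smooth radial kernel of size `r` around `x`, and `potential x r`
the nonnegative compactly supported function with gradient `-(bump x r z / r²) • (z - x)`. The
`r`-derivative of `r⁻ᴺ bump x r` is `r¹⁻ᴺ` times the Laplacian of `potential x r`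
(`hasDerivAt_bump_scale`). Hence for a weak solution of `Δ u = f` the averages of `u` against
`bump x r` have `r`-derivative `r¹⁻ᴺ ∫ f * potential x r` (`hasDerivAt_bumpMean`). This gives the
sub-mean value property if `0 ≤ f`, and the mean value property if `f = 0`. From the latter, a
harmonic function of sublinear growth is constant (`eq_zero_value_of_weaklyHarmonic`), which settles
the components other than a vanishing one.

*A component vanishes.* Assume that none does, and let `S i R` be the supremum of `u i` over the
ball of radius `R` around the origin. As all `S i` grow at most like `R ^ α` with `α` small and are
nondecreasing in `R`, there are arbitrarily large `R` with `S i (7 R) ≤ (1 + ε) S i R` for all `i`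
at once (`exists_common_slow_step`). At such a scale, the sub-mean value property at a maximum point
of `u i` in the ball of radius `R` shows that `u i` is close to `T i = S i (7 R)` on average over
the ball of radius `2 R` (`integral_sub_mul_potential_le`). Therefore all components are simultaneously
comparable to the `T i` on most of that ball, and `∫ Δ (u i) * potential 0 R` is at least of order
`M * T i * ∏_{j ≠ i} T j ^ 2 * R ^ N`. Moving the Laplacian to the potential, it is at most of order
`T i * R ^ (N - 2)`. So `M * ∏_{j ≠ i} T j ^ 2 * R ^ 2` stays bounded (`exists_prod_mul_sq_le`),
which is absurd as `R → ∞`, since the `T j` do not decrease.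
-/

/-! ### A radial kernel and its potential -/

/-- The profile of the averaging kernel `y ↦ cutoff (‖y‖ ^ 2)`: a smooth function equal to `1` on
`(-∞, 1]` and to `0` on `[2, ∞)`. -/
noncomputable def cutoff (t : ℝ) : ℝ := Real.smoothTransition (2 - t)

lemma cutoff_contDiff : ContDiff ℝ ∞ cutoff :=
  (Real.smoothTransition.contDiff (n := ⊤)).comp (contDiff_const.sub contDiff_id)

lemma cutoff_nonneg (t : ℝ) : 0 ≤ cutoff t := Real.smoothTransition.nonneg _

lemma cutoff_le_one (t : ℝ) : cutoff t ≤ 1 := Real.smoothTransition.le_one _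

lemma cutoff_eq_one {t : ℝ} (h : t ≤ 1) : cutoff t = 1 :=
  Real.smoothTransition.one_of_one_le (by linarith)

lemma cutoff_eq_zero {t : ℝ} (h : 2 ≤ t) : cutoff t = 0 :=
  Real.smoothTransition.zero_of_nonpos (by linarith)

lemma cutoff_differentiable : Differentiable ℝ cutoff :=
  cutoff_contDiff.differentiable (by simp)

lemma deriv_cutoff_eq_zero {t : ℝ} (h : 2 < t) : deriv cutoff t = 0 := by
  have : cutoff =ᶠ[nhds t] fun _ => 0 := by
    filter_upwards [lt_mem_nhds h] with s hs using cutoff_eq_zero hs.le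
  rw [this.deriv_eq]; simp

/-- The primitive of `-cutoff / 2` that vanishes on `[2, ∞)`. The factor is chosen such that the
gradient of `y ↦ cutoffPrimitive (‖y‖ ^ 2)` is `-cutoff (‖y‖ ^ 2) • y`. -/
noncomputable def cutoffPrimitive (t : ℝ) : ℝ := (1 / 2) * ∫ s in t..2, cutoff s

lemma cutoffPrimitive_hasDerivAt (t : ℝ) : HasDerivAt cutoffPrimitive (-(cutoff t) / 2) t := by
  have hc := cutoff_contDiff.continuous
  have := (intervalIntegral.integral_hasDerivAt_left (hc.intervalIntegrable t 2)
    (hc.stronglyMeasurableAtFilter _ _) hc.continuousAt).const_mul (1 / 2 : ℝ)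
  exact this.congr_deriv (by ring)

lemma cutoffPrimitive_contDiff : ContDiff ℝ ∞ cutoffPrimitive := by
  rw [contDiff_infty_iff_deriv]
  refine ⟨fun t => (cutoffPrimitive_hasDerivAt t).differentiableAt, ?_⟩
  have : deriv cutoffPrimitive = fun t => -(cutoff t) / 2 :=
    funext fun t => (cutoffPrimitive_hasDerivAt t).deriv
  rw [this]
  exact cutoff_contDiff.neg.div_const 2

lemma cutoffPrimitive_eq_zero {t : ℝ} (h : 2 ≤ t) : cutoffPrimitive t = 0 := by
  have : ∫ s in t..2, cutoff s = ∫ s in t..2, (0 : ℝ) :=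
    intervalIntegral.integral_congr fun s hs => by
      rw [Set.uIcc_of_ge h] at hs
      exact cutoff_eq_zero hs.1
  simp [cutoffPrimitive, this]

lemma cutoffPrimitive_nonneg (t : ℝ) : 0 ≤ cutoffPrimitive t := by
  rcases le_total t 2 with h | h
  · exact mul_nonneg (by norm_num)
      (intervalIntegral.integral_nonneg h fun s _ => cutoff_nonneg s)
  · exact (cutoffPrimitive_eq_zero h).ge

lemma cutoffPrimitive_le_one {t : ℝ} (h : 0 ≤ t) : cutoffPrimitive t ≤ 1 := by
  rcases le_total t 2 with h2 | h2
  · have hc := cutoff_contDiff.continuous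
    have : ∫ s in t..2, cutoff s ≤ ∫ s in t..2, (1 : ℝ) :=
      intervalIntegral.integral_mono_on h2 (hc.intervalIntegrable _ _)
        (continuous_const.intervalIntegrable _ _) fun s _ => cutoff_le_one s
    simp only [intervalIntegral.integral_const, smul_eq_mul, mul_one] at this
    rw [cutoffPrimitive]; linarith
  · rw [cutoffPrimitive_eq_zero h2]; norm_num

lemma cutoffPrimitive_zero_pos : 0 < cutoffPrimitive 0 := by
  have hc := cutoff_contDiff.continuous
  refine mul_pos (by norm_num) (intervalIntegral.integral_pos (by norm_num) hc.continuousOn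
    (fun s _ => cutoff_nonneg s) ⟨0, by norm_num, ?_⟩)
  rw [cutoff_eq_one (by norm_num)]; norm_num

section Potential

variable {N : ℕ}

/-- The kernel `z ↦ cutoff (‖z - x‖² / r²)`, not normalised: the bump at `x` of size `r`. -/
noncomputable def bump (x : EuclideanSpace ℝ (Fin N)) (r : ℝ) (z : EuclideanSpace ℝ (Fin N)) : ℝ :=
  cutoff (‖z - x‖ ^ 2 / r ^ 2)

/-- The potential of the kernel `bump`: the smooth function `z ↦ cutoffPrimitive (‖z - x‖² / r²)`,
whose gradient is `-(bump x r z / r²) • (z - x)`. -/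
noncomputable def potential (x : EuclideanSpace ℝ (Fin N)) (r : ℝ)
    (z : EuclideanSpace ℝ (Fin N)) : ℝ :=
  cutoffPrimitive (‖z - x‖ ^ 2 / r ^ 2)

/-- The Laplacian of a function on `ℝ^N`, as the sum of its pure second partial derivatives. -/
noncomputable def euclideanLaplacian (φ : EuclideanSpace ℝ (Fin N) → ℝ)
    (z : EuclideanSpace ℝ (Fin N)) : ℝ :=
  ∑ i, fderiv ℝ (fun y => fderiv ℝ φ y (EuclideanSpace.single i 1)) z (EuclideanSpace.single i 1)

lemma bump_contDiff (x : EuclideanSpace ℝ (Fin N)) (r : ℝ) : ContDiff ℝ ∞ (bump x r) :=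
  cutoff_contDiff.comp (((contDiff_id.sub contDiff_const).norm_sq ℝ).div_const _)

lemma potential_contDiff (x : EuclideanSpace ℝ (Fin N)) (r : ℝ) : ContDiff ℝ ∞ (potential x r) :=
  cutoffPrimitive_contDiff.comp (((contDiff_id.sub contDiff_const).norm_sq ℝ).div_const _)

lemma two_lt_normSq_div {x z : EuclideanSpace ℝ (Fin N)} {r : ℝ} (hr : 0 < r)
    (h : 2 * r ≤ ‖z - x‖) : 2 < ‖z - x‖ ^ 2 / r ^ 2 := by
  rw [lt_div_iff₀ (by positivity)]
  nlinarith [sq_nonneg r, pow_pos hr 2]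

lemma bump_eq_zero {x z : EuclideanSpace ℝ (Fin N)} {r : ℝ} (hr : 0 < r)
    (h : 2 * r ≤ ‖z - x‖) : bump x r z = 0 :=
  cutoff_eq_zero (two_lt_normSq_div hr h).le

lemma bump_eq_one {x z : EuclideanSpace ℝ (Fin N)} {r : ℝ} (hr : 0 < r)
    (h : ‖z - x‖ ≤ r) : bump x r z = 1 := by
  refine cutoff_eq_one ?_
  rw [div_le_one (by positivity)]
  gcongr

lemma potential_eq_zero {x z : EuclideanSpace ℝ (Fin N)} {r : ℝ} (hr : 0 < r)
    (h : 2 * r ≤ ‖z - x‖) : potential x r z = 0 :=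
  cutoffPrimitive_eq_zero (two_lt_normSq_div hr h).le

lemma bump_hasCompactSupport (x : EuclideanSpace ℝ (Fin N)) {r : ℝ} (hr : 0 < r) :
    HasCompactSupport (bump x r) :=
  HasCompactSupport.intro (isCompact_closedBall x (2 * r)) fun z hz => by
    rw [Metric.mem_closedBall, dist_eq_norm, not_le] at hz
    exact bump_eq_zero hr hz.le

lemma potential_hasCompactSupport (x : EuclideanSpace ℝ (Fin N)) {r : ℝ} (hr : 0 < r) :
    HasCompactSupport (potential x r) :=
  HasCompactSupport.intro (isCompact_closedBall x (2 * r)) fun z hz => by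
    rw [Metric.mem_closedBall, dist_eq_norm, not_le] at hz
    exact potential_eq_zero hr hz.le

lemma hasFDerivAt_normSq_div (x z : EuclideanSpace ℝ (Fin N)) (r : ℝ) :
    HasFDerivAt (fun z : EuclideanSpace ℝ (Fin N) => ‖z - x‖ ^ 2 / r ^ 2)
      ((r ^ 2)⁻¹ • (2 • (innerSL ℝ (z - x)))) z := by
  have h := ((hasFDerivAt_id z).sub_const x).norm_sq
  simpa [div_eq_inv_mul] using h.const_mul ((r ^ 2)⁻¹)

lemma fderiv_potential (x z v : EuclideanSpace ℝ (Fin N)) (r : ℝ) :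
    fderiv ℝ (potential x r) z v = -(r ^ 2)⁻¹ * (bump x r z * inner ℝ (z - x) v) := by
  have h : HasFDerivAt (potential x r) _ z :=
    (cutoffPrimitive_hasDerivAt (‖z - x‖ ^ 2 / r ^ 2)).comp_hasFDerivAt z
      (hasFDerivAt_normSq_div x z r)
  rw [h.fderiv]
  simp [bump, inner_sub_left]
  ring

/-- The Laplacian of the potential: the divergence of `-(bump x r z / r²) • (z - x)`. -/
lemma euclideanLaplacian_potential (x z : EuclideanSpace ℝ (Fin N)) (r : ℝ) :
    euclideanLaplacian (potential x r) z =
      -(r ^ 2)⁻¹ * (N * bump x r z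
        + 2 * (‖z - x‖ ^ 2 / r ^ 2) * deriv cutoff (‖z - x‖ ^ 2 / r ^ 2)) := by
  have key : ∀ v : EuclideanSpace ℝ (Fin N),
      fderiv ℝ (fun y => fderiv ℝ (potential x r) y v) z v = -(r ^ 2)⁻¹ * (bump x r z * ‖v‖ ^ 2
        + 2 * ((r ^ 2)⁻¹ * inner ℝ (z - x) v ^ 2) * deriv cutoff (‖z - x‖ ^ 2 / r ^ 2)) := by
    intro v
    have h1 : HasFDerivAt (bump x r) _ z :=
      (cutoff_differentiable (‖z - x‖ ^ 2 / r ^ 2)).hasDerivAt.comp_hasFDerivAt z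
        (hasFDerivAt_normSq_div x z r)
    have h2 : HasFDerivAt (fun y : EuclideanSpace ℝ (Fin N) => inner ℝ (y - x) v)
        (innerSL ℝ v) z := by
      have := (innerSL ℝ v).hasFDerivAt.comp z ((hasFDerivAt_id z).sub_const x)
      refine (this.congr_of_eventuallyEq (Filter.Eventually.of_forall fun y => ?_)).congr_fderiv ?_
      · simp [real_inner_comm]
      · ext w; simp
    simp_rw [fderiv_potential]
    have h3 : HasFDerivAt (fun y => -(r ^ 2)⁻¹ * (bump x r y * inner ℝ (y - x) v)) _ z :=
      (h1.mul h2).const_mul _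
    rw [h3.fderiv]
    simp [inner_sub_left]
    ring
  have hs : ∑ i, inner ℝ (z - x) (EuclideanSpace.single i (1 : ℝ)) ^ 2 = ‖z - x‖ ^ 2 := by
    rw [EuclideanSpace.real_norm_sq_eq]
    simp [EuclideanSpace.inner_single_right]
  simp_rw [euclideanLaplacian, key]
  rw [← Finset.mul_sum, Finset.sum_add_distrib, ← Finset.mul_sum, ← Finset.sum_mul,
    ← Finset.mul_sum, ← Finset.mul_sum, hs]
  simp only [PiLp.norm_single, norm_one, one_pow, Finset.sum_const, Finset.card_univ,
    Fintype.card_fin, nsmul_eq_mul]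
  ring

end Potential

section Mean

variable {N : ℕ}

/-! ### The distributional form of the equation -/

lemma IsTestFunction.fderiv_apply {φ : EuclideanSpace ℝ (Fin N) → ℝ} (hφ : IsTestFunction φ)
    (v : EuclideanSpace ℝ (Fin N)) : IsTestFunction fun z => fderiv ℝ φ z v :=
  ⟨(hφ.1.fderiv_right (m := ∞) (by simp)).clm_apply contDiff_const, hφ.2.fderiv_apply (𝕜 := ℝ) v⟩

lemma IsTestFunction.integrable_mul {u φ : EuclideanSpace ℝ (Fin N) → ℝ} (hφ : IsTestFunction φ)
    (hu : LocallyIntegrable u) : Integrable fun z => u z * φ z := by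
  simpa [mul_comm] using
    hu.integrable_smul_left_of_hasCompactSupport hφ.1.continuous hφ.2

lemma MemL2Loc.locallyIntegrable {F : Type*} [NormedAddCommGroup F]
    {G : EuclideanSpace ℝ (Fin N) → F} (hG : MemL2Loc G) : LocallyIntegrable G := by
  rw [locallyIntegrable_iff]
  intro K hK
  have : IsFiniteMeasure (volume.restrict K) := ⟨by simpa using hK.measure_lt_top⟩
  exact (hG K hK).integrable (by norm_num)

lemma locallyIntegrable_inner_const {G : EuclideanSpace ℝ (Fin N) → EuclideanSpace ℝ (Fin N)}
    (hG : LocallyIntegrable G) (v : EuclideanSpace ℝ (Fin N)) :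
    LocallyIntegrable fun z => inner ℝ (G z) v := by
  rw [locallyIntegrable_iff] at hG ⊢
  exact fun K hK => (hG K hK).inner_const v

/-- A weak solution of `Δ u = f` is a distributional solution. -/
lemma IsWeakSolutionLaplace.integral_mul_euclideanLaplacian
    {u f : EuclideanSpace ℝ (Fin N) → ℝ} (hu : Continuous u) (h : IsWeakSolutionLaplace u f)
    {φ : EuclideanSpace ℝ (Fin N) → ℝ} (hφ : IsTestFunction φ) :
    ∫ z, u z * euclideanLaplacian φ z = ∫ z, f z * φ z := by
  obtain ⟨G, hG, hw⟩ := h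
  have hG1 := hG.memL2Loc_gradient.locallyIntegrable
  simp_rw [euclideanLaplacian, Finset.mul_sum]
  rw [integral_finsetSum _ fun i _ =>
    ((hφ.fderiv_apply _).fderiv_apply _).integrable_mul hu.locallyIntegrable]
  simp_rw [hG.integral_eq _ (hφ.fderiv_apply _)]
  rw [Finset.sum_neg_distrib, ← integral_finsetSum, neg_eq_iff_eq_neg, ← hw φ hφ]
  · congr 1
    ext z
    have : ∀ i, fderiv ℝ φ z (EuclideanSpace.single i 1) = gradient φ z i := fun i => by
      rw [gradient, ← InnerProductSpace.toDual_symm_apply, EuclideanSpace.inner_single_right]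
      simp
    simp only [this, PiLp.inner_apply]
    simp
  · intro i _
    simpa only [mul_comm] using
      (hφ.fderiv_apply (EuclideanSpace.single i 1)).integrable_mul
        (locallyIntegrable_inner_const hG1 (EuclideanSpace.single i 1))

lemma potential_isTestFunction (x : EuclideanSpace ℝ (Fin N)) {r : ℝ} (hr : 0 < r) :
    IsTestFunction (potential x r) :=
  ⟨potential_contDiff x r, potential_hasCompactSupport x hr⟩

lemma euclideanLaplacian_potential_eq_zero {x z : EuclideanSpace ℝ (Fin N)} {r : ℝ} (hr : 0 < r)
    (h : 2 * r ≤ ‖z - x‖) : euclideanLaplacian (potential x r) z = 0 := by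
  rw [euclideanLaplacian_potential, bump_eq_zero hr h,
    deriv_cutoff_eq_zero (two_lt_normSq_div hr h)]
  ring

lemma continuous_euclideanLaplacian {φ : EuclideanSpace ℝ (Fin N) → ℝ} (hφ : IsTestFunction φ) :
    Continuous (euclideanLaplacian φ) :=
  continuous_finsetSum _ fun _ _ => ((hφ.fderiv_apply _).fderiv_apply _).1.continuous

/-- The Laplacian of the potential is `O(r⁻²)`, by scaling. -/
lemma exists_abs_euclideanLaplacian_potential_le (N : ℕ) :
    ∃ H : ℝ, 0 ≤ H ∧ ∀ (x z : EuclideanSpace ℝ (Fin N)) (r : ℝ), 0 < r →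
      |euclideanLaplacian (potential x r) z| ≤ H * (r ^ 2)⁻¹ := by
  have hd : Continuous (deriv cutoff) := (contDiff_infty_iff_deriv.1 cutoff_contDiff).2.continuous
  have hc := cutoff_contDiff.continuous
  obtain ⟨H, hH⟩ := (isCompact_Icc (a := (0 : ℝ)) (b := 2)).exists_bound_of_continuousOn
    (f := fun q => N * cutoff q + 2 * q * deriv cutoff q) (by fun_prop)
  have hH0 : 0 ≤ H := (norm_nonneg _).trans (hH 0 (by simp))
  refine ⟨H, hH0, fun x z r hr => ?_⟩
  rcases le_or_gt (2 * r) ‖z - x‖ with h | h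
  · rw [euclideanLaplacian_potential_eq_zero hr h]
    simp only [abs_zero]
    positivity
  · rw [euclideanLaplacian_potential, abs_mul, abs_neg, abs_of_pos (a := (r ^ 2)⁻¹) (by positivity),
      mul_comm]
    gcongr
    rcases le_or_gt (‖z - x‖ ^ 2 / r ^ 2) 2 with hq | hq
    · exact hH _ ⟨by positivity, hq⟩
    · rw [deriv_cutoff_eq_zero hq, bump, cutoff_eq_zero hq.le]
      simpa using hH0

/-! ### Averages against the kernel -/

/-- The average of `u` around `x` at scale `r` against the kernel `bump`, not normalised. -/
noncomputable def bumpMean (u : EuclideanSpace ℝ (Fin N) → ℝ) (x : EuclideanSpace ℝ (Fin N))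
    (r : ℝ) : ℝ :=
  ∫ y, u (x + r • y) * bump 0 1 y

lemma bumpMean_continuous {u : EuclideanSpace ℝ (Fin N) → ℝ} (hu : Continuous u)
    (x : EuclideanSpace ℝ (Fin N)) : Continuous (bumpMean u x) := by
  have hb := (bump_contDiff (0 : EuclideanSpace ℝ (Fin N)) 1).continuous
  rw [← continuousOn_univ]
  refine continuousOn_integral_of_compact_support
    (bump_hasCompactSupport (0 : EuclideanSpace ℝ (Fin N)) one_pos)
    (Continuous.continuousOn ?_) fun r y _ hy => ?_
  · unfold Function.uncurry
    fun_prop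
  · rw [image_eq_zero_of_notMem_tsupport hy, mul_zero]

lemma bumpMean_zero (u : EuclideanSpace ℝ (Fin N) → ℝ) (x : EuclideanSpace ℝ (Fin N)) :
    bumpMean u x 0 = u x * ∫ y : EuclideanSpace ℝ (Fin N), bump 0 1 y := by
  simp [bumpMean, integral_const_mul]

lemma bump_add_smul (x y : EuclideanSpace ℝ (Fin N)) {r : ℝ} (hr : 0 < r) (s : ℝ) :
    bump x (r * s) (x + r • y) = bump 0 s y := by
  simp only [bump, add_sub_cancel_left, norm_smul, Real.norm_eq_abs, abs_of_pos hr, sub_zero]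
  congr 1
  rw [mul_pow, mul_pow, mul_div_mul_left _ _ (by positivity)]

lemma potential_add_smul (x y : EuclideanSpace ℝ (Fin N)) {r : ℝ} (hr : 0 < r) (s : ℝ) :
    potential x (r * s) (x + r • y) = potential 0 s y := by
  simp only [potential, add_sub_cancel_left, norm_smul, Real.norm_eq_abs, abs_of_pos hr, sub_zero]
  congr 1
  rw [mul_pow, mul_pow, mul_div_mul_left _ _ (by positivity)]

lemma integral_comp_add_smul (F : EuclideanSpace ℝ (Fin N) → ℝ) (x : EuclideanSpace ℝ (Fin N))
    {r : ℝ} (hr : 0 < r) : ∫ y, F (x + r • y) = (r ^ N)⁻¹ * ∫ z, F z := by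
  rw [Measure.integral_comp_smul volume (fun z => F (x + z)) r,
    integral_add_left_eq_self (μ := volume) F x]
  simp [abs_of_pos hr]

lemma bumpMean_eq (u : EuclideanSpace ℝ (Fin N) → ℝ) (x : EuclideanSpace ℝ (Fin N))
    {r : ℝ} (hr : 0 < r) : bumpMean u x r = (r ^ N)⁻¹ * ∫ z, u z * bump x r z := by
  rw [← integral_comp_add_smul _ x hr, bumpMean]
  congr 1
  ext y
  have := bump_add_smul x y hr 1
  rw [mul_one] at this
  rw [this]

/-- The derivative in the scale of the kernel with fixed mass is a multiple of the Laplacian of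
the potential. -/
lemma hasDerivAt_bump_scale (x z : EuclideanSpace ℝ (Fin N)) {r : ℝ} (hr : 0 < r) :
    HasDerivAt (fun s => (s ^ N)⁻¹ * bump x s z)
      ((r ^ N)⁻¹ * r * euclideanLaplacian (potential x r) z) r := by
  have hr' := hr.ne'
  have h1 : HasDerivAt (fun s : ℝ => (s ^ N)⁻¹) (-(N * (r ^ N)⁻¹ * r⁻¹)) r := by
    refine ((hasDerivAt_pow N r).inv (by positivity)).congr_deriv ?_
    rcases N with _ | n
    · simp
    · simp only [Nat.add_sub_cancel]
      field_simp
      ring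
  have h2 : HasDerivAt (fun s : ℝ => ‖z - x‖ ^ 2 / s ^ 2)
      (-(2 * (‖z - x‖ ^ 2 / r ^ 2) * r⁻¹)) r := by
    refine ((hasDerivAt_const r (‖z - x‖ ^ 2)).div (hasDerivAt_pow 2 r)
      (by positivity)).congr_deriv ?_
    field_simp
    ring
  have h3 := h1.mul ((cutoff_differentiable _).hasDerivAt.comp r h2)
  refine h3.congr_deriv ?_
  rw [euclideanLaplacian_potential, bump]
  simp only [Function.comp]
  field_simp
  ring

/-- Differentiating the averages of `u` in the scale brings out the right-hand side of
`Δ u = f`, tested against the potential. -/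
lemma hasDerivAt_bumpMean {u f : EuclideanSpace ℝ (Fin N) → ℝ} (hu : Continuous u)
    (h : IsWeakSolutionLaplace u f) (x : EuclideanSpace ℝ (Fin N)) {r : ℝ} (hr : 0 < r) :
    HasDerivAt (bumpMean u x) ((r ^ N)⁻¹ * r * ∫ z, f z * potential x r z) r := by
  have hb : ∀ s, Continuous (bump x s) := fun s => (bump_contDiff x s).continuous
  have hlap := continuous_euclideanLaplacian (potential_isTestFunction x hr)
  obtain ⟨H, hH0, hH⟩ := exists_abs_euclideanLaplacian_potential_le N
  -- a bound for the `s`-derivative of the kernel that is uniform in `s ∈ (r / 2, 3 / 2 * r)`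
  set c : ℝ := ((r / 2) ^ N)⁻¹ * (3 / 2 * r) * (H * ((r / 2) ^ 2)⁻¹) with hc
  have hK : IsCompact (Metric.closedBall x (3 * r)) := isCompact_closedBall x _
  have key := hasDerivAt_integral_of_dominated_loc_of_deriv_le (μ := volume)
    (F := fun s z => u z * ((s ^ N)⁻¹ * bump x s z))
    (F' := fun s z => u z * ((s ^ N)⁻¹ * s * euclideanLaplacian (potential x s) z))
    (x₀ := r) (s := Metric.ball r (r / 2))
    (bound := (Metric.closedBall x (3 * r)).indicator fun z => |u z| * c)
    (Metric.ball_mem_nhds r (by positivity)) ?_ ?_ ?_ ?_ ?_ ?_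
  · have hI : (r ^ N)⁻¹ * r * ∫ z, f z * potential x r z
        = ∫ z, u z * ((r ^ N)⁻¹ * r * euclideanLaplacian (potential x r) z) := by
      rw [← h.integral_mul_euclideanLaplacian hu (potential_isTestFunction x hr),
        ← integral_const_mul]
      congr 1; ext z; ring
    rw [hI]
    refine key.2.congr_of_eventuallyEq ?_
    filter_upwards [lt_mem_nhds hr] with s hs
    rw [bumpMean_eq u x hs, ← integral_const_mul]
    congr 1; ext z; ring
  · exact Filter.Eventually.of_forall fun s => by
      have := hb s
      exact Continuous.aestronglyMeasurable (by fun_prop)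
  · have := hb r
    refine Continuous.integrable_of_hasCompactSupport (by fun_prop) ?_
    exact ((bump_hasCompactSupport x hr).mul_left).mul_left
  · exact Continuous.aestronglyMeasurable (by fun_prop)
  · refine Filter.Eventually.of_forall fun z s hs => ?_
    rw [Metric.mem_ball, Real.dist_eq, abs_lt] at hs
    have hs0 : 0 < s := by linarith
    by_cases hz : z ∈ Metric.closedBall x (3 * r)
    · rw [Set.indicator_of_mem hz, Real.norm_eq_abs, abs_mul, abs_mul, abs_mul,
        abs_of_pos (a := (s ^ N)⁻¹) (by positivity), abs_of_pos hs0, hc]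
      gcongr
      · linarith
      · linarith
      · refine (hH x z s hs0).trans ?_
        gcongr
        linarith
    · rw [Set.indicator_of_notMem hz]
      rw [Metric.mem_closedBall, dist_eq_norm, not_le] at hz
      rw [euclideanLaplacian_potential_eq_zero hs0 (by linarith)]
      simp
  · exact IntegrableOn.integrable_indicator
      (ContinuousOn.integrableOn_compact hK (by fun_prop)) hK.measurableSet
  · refine Filter.Eventually.of_forall fun z s hs => ?_
    rw [Metric.mem_ball, Real.dist_eq, abs_lt] at hs
    exact (hasDerivAt_bump_scale x z (by linarith)).const_mul _

/-- The sub-mean value property of weakly subharmonic functions. -/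
lemma mul_integral_bump_le_bumpMean {u f : EuclideanSpace ℝ (Fin N) → ℝ} (hu : Continuous u)
    (h : IsWeakSolutionLaplace u f) (hf : ∀ z, 0 ≤ f z) (x : EuclideanSpace ℝ (Fin N)) {r : ℝ}
    (hr : 0 < r) : u x * ∫ y : EuclideanSpace ℝ (Fin N), bump 0 1 y ≤ bumpMean u x r := by
  rw [← bumpMean_zero]
  refine monotoneOn_of_deriv_nonneg (convex_Ici 0) (bumpMean_continuous hu x).continuousOn
    (fun s hs => ?_) (fun s hs => ?_) Set.self_mem_Ici hr.le hr.le
  · rw [interior_Ici] at hs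
    exact (hasDerivAt_bumpMean hu h x hs).differentiableAt.differentiableWithinAt
  · rw [interior_Ici] at hs
    have hs' : (0 : ℝ) < s := hs
    rw [(hasDerivAt_bumpMean hu h x hs).deriv]
    exact mul_nonneg (by positivity)
      (integral_nonneg fun z => mul_nonneg (hf z) (cutoffPrimitive_nonneg _))

/-- The mean value property of weakly harmonic functions. -/
lemma mul_integral_bump_eq_bumpMean {u : EuclideanSpace ℝ (Fin N) → ℝ} (hu : Continuous u)
    (h : IsWeakSolutionLaplace u fun _ => 0) (x : EuclideanSpace ℝ (Fin N)) {r : ℝ}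
    (hr : 0 < r) : u x * ∫ y : EuclideanSpace ℝ (Fin N), bump 0 1 y = bumpMean u x r := by
  refine le_antisymm (mul_integral_bump_le_bumpMean hu h (fun _ => le_rfl) x hr) ?_
  rw [← bumpMean_zero]
  refine antitoneOn_of_deriv_nonpos (convex_Ici 0) (bumpMean_continuous hu x).continuousOn
    (fun s hs => ?_) (fun s hs => ?_) Set.self_mem_Ici hr.le hr.le
  · rw [interior_Ici] at hs
    exact (hasDerivAt_bumpMean hu h x hs).differentiableAt.differentiableWithinAt
  · rw [interior_Ici] at hs
    rw [(hasDerivAt_bumpMean hu h x hs).deriv]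
    simp

lemma integral_bump_pos : 0 < ∫ y : EuclideanSpace ℝ (Fin N), bump 0 1 y := by
  refine Continuous.integral_pos_of_hasCompactSupport_nonneg_nonzero (x := 0)
    (bump_contDiff 0 1).continuous (bump_hasCompactSupport 0 one_pos)
    (fun y => cutoff_nonneg _) ?_
  rw [bump_eq_one one_pos (by simp)]
  exact one_ne_zero

lemma integral_potential_pos : 0 < ∫ y : EuclideanSpace ℝ (Fin N), potential 0 1 y := by
  refine Continuous.integral_pos_of_hasCompactSupport_nonneg_nonzero (x := 0)
    (potential_contDiff 0 1).continuous (potential_hasCompactSupport 0 one_pos)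
    (fun y => cutoffPrimitive_nonneg _) ?_
  simpa [potential] using cutoffPrimitive_zero_pos.ne'

end Mean

section Liouville

variable {N : ℕ}

/-! ### The Liouville theorem for sublinear harmonic functions -/

lemma bump_eq_bump_zero_one (x z : EuclideanSpace ℝ (Fin N)) {r : ℝ} (hr : 0 < r) :
    bump x r z = bump 0 1 (r⁻¹ • (z - x)) := by
  have := bump_add_smul x (r⁻¹ • (z - x)) hr 1
  rwa [smul_inv_smul₀ hr.ne', add_sub_cancel, mul_one] at this

lemma exists_abs_bump_sub_bump_le (N : ℕ) : ∃ L : ℝ, 0 ≤ L ∧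
    ∀ (x x' z : EuclideanSpace ℝ (Fin N)) (r : ℝ), 0 < r →
      |bump x r z - bump x' r z| ≤ L * (‖x - x'‖ / r) := by
  obtain ⟨L, hL⟩ := ContDiff.lipschitzWith_of_hasCompactSupport
    (bump_hasCompactSupport (0 : EuclideanSpace ℝ (Fin N)) one_pos) (bump_contDiff 0 1) (by simp)
  refine ⟨L, L.2, fun x x' z r hr => ?_⟩
  have h := hL.dist_le_mul (r⁻¹ • (z - x)) (r⁻¹ • (z - x'))
  rw [← bump_eq_bump_zero_one x z hr, ← bump_eq_bump_zero_one x' z hr, Real.dist_eq, dist_eq_norm,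
    ← smul_sub, norm_smul, Real.norm_eq_abs, abs_of_pos (inv_pos.2 hr), sub_sub_sub_cancel_left,
    norm_sub_rev] at h
  rwa [div_eq_inv_mul]

/-- A weakly harmonic function of sublinear growth is constant: the averaging kernels of a large
size `r` around two given points differ by `O(1/r)`. -/
lemma eq_zero_value_of_weaklyHarmonic {u : EuclideanSpace ℝ (Fin N) → ℝ} (hu : Continuous u)
    (h : IsWeakSolutionLaplace u fun _ => 0) {C β : ℝ} (hC : 0 ≤ C) (hβ0 : 0 ≤ β) (hβ : β < 1)
    (hgrowth : ∀ x, |u x| ≤ C * (1 + ‖x‖) ^ β) (x : EuclideanSpace ℝ (Fin N)) : u x = u 0 := by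
  obtain ⟨L, hL0, hL⟩ := exists_abs_bump_sub_bump_le N
  have hI : 0 < ∫ y : EuclideanSpace ℝ (Fin N), bump 0 1 y := integral_bump_pos
  set I := ∫ y : EuclideanSpace ℝ (Fin N), bump 0 1 y
  set V := volume.real (Metric.ball (0 : EuclideanSpace ℝ (Fin N)) 1)
  have bound : ∀ r : ℝ, max 1 ‖x‖ ≤ r →
      |u x - u 0| * I ≤ (C * 4 ^ β * (L * ‖x‖) * (3 ^ N * V)) * r ^ (-(1 - β)) := by
    intro r hr
    have hr1 : 1 ≤ r := (le_max_left _ _).trans hr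
    have hrx : ‖x‖ ≤ r := (le_max_right _ _).trans hr
    have hr0 : 0 < r := by linarith
    have hint : ∀ w, Integrable fun z => u z * bump w r z := fun w =>
      IsTestFunction.integrable_mul ⟨bump_contDiff w r, bump_hasCompactSupport w hr0⟩
        hu.locallyIntegrable
    have h1 : (u x - u 0) * I = (r ^ N)⁻¹ *
        ∫ z in Metric.closedBall 0 (3 * r), u z * (bump x r z - bump 0 r z) := by
      rw [setIntegral_eq_integral_of_forall_compl_eq_zero, sub_mul,
        mul_integral_bump_eq_bumpMean hu h x hr0, mul_integral_bump_eq_bumpMean hu h 0 hr0,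
        bumpMean_eq u x hr0, bumpMean_eq u 0 hr0, ← mul_sub, ← integral_sub (hint x) (hint 0)]
      · simp_rw [mul_sub]
      · intro z hz
        rw [mem_closedBall_zero_iff, not_le] at hz
        have := norm_sub_norm_le z x
        rw [bump_eq_zero hr0 (by linarith), bump_eq_zero hr0 (by rw [sub_zero]; linarith)]
        simp
    have h2 : ‖∫ z in Metric.closedBall 0 (3 * r), u z * (bump x r z - bump 0 r z)‖ ≤
        (C * (4 * r) ^ β * (L * (‖x‖ / r))) *
          volume.real (Metric.closedBall (0 : EuclideanSpace ℝ (Fin N)) (3 * r)) := by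
      refine norm_setIntegral_le_of_norm_le_const measure_closedBall_lt_top fun z hz => ?_
      rw [mem_closedBall_zero_iff] at hz
      rw [norm_mul, Real.norm_eq_abs, Real.norm_eq_abs]
      refine mul_le_mul ((hgrowth z).trans ?_) (by simpa using hL x 0 z r hr0) (abs_nonneg _)
        (by positivity)
      gcongr
      linarith
    rw [Measure.addHaar_real_closedBall _ _ (by positivity)] at h2
    rw [← abs_of_pos hI, ← abs_mul, h1, abs_mul, abs_of_pos (by positivity)]
    refine (mul_le_mul_of_nonneg_left h2 (by positivity)).trans (le_of_eq ?_)
    rw [Real.mul_rpow (by norm_num) hr0.le, neg_sub, Real.rpow_sub_one hr0.ne']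
    simp only [finrank_euclideanSpace, Fintype.card_fin, mul_pow]
    field_simp
    rfl
  have lim : Filter.Tendsto (fun r : ℝ =>
      (C * 4 ^ β * (L * ‖x‖) * (3 ^ N * V)) * r ^ (-(1 - β))) Filter.atTop (nhds 0) := by
    simpa using (tendsto_rpow_neg_atTop (sub_pos.2 hβ)).const_mul
      (C * 4 ^ β * (L * ‖x‖) * (3 ^ N * V))
  have h0 : |u x - u 0| * I ≤ 0 :=
    ge_of_tendsto lim ((Filter.eventually_ge_atTop (max 1 ‖x‖)).mono bound)
  have h3 : |u x - u 0| ≤ 0 := nonpos_of_mul_nonpos_left h0 hI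
  exact sub_eq_zero.1 (abs_nonpos_iff.1 h3)

end Liouville

/-! ### Scales at which all components grow slowly -/

lemma one_sub_sum_one_sub_le_prod {ι : Type*} (s : Finset ι) (b : ι → ℝ)
    (h0 : ∀ j ∈ s, 0 ≤ b j) (h1 : ∀ j ∈ s, b j ≤ 1) :
    1 - ∑ j ∈ s, (1 - b j) ≤ ∏ j ∈ s, b j := by
  classical
  induction s using Finset.induction_on with
  | empty => simp
  | insert i s hi ih =>
    rw [Finset.sum_insert hi, Finset.prod_insert hi]
    have ih' := ih (fun j hj => h0 j (Finset.mem_insert_of_mem hj))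
      (fun j hj => h1 j (Finset.mem_insert_of_mem hj))
    have hs : 0 ≤ ∑ j ∈ s, (1 - b j) :=
      Finset.sum_nonneg fun j hj => sub_nonneg.2 (h1 j (Finset.mem_insert_of_mem hj))
    have hb0 := h0 i (Finset.mem_insert_self i s)
    have hb1 := h1 i (Finset.mem_insert_self i s)
    nlinarith [mul_le_mul_of_nonneg_left ih' hb0, mul_nonneg (sub_nonneg.2 hb1) hs]

/-- The reaction term, for components normalised to take values in `[0, 1]`, is close to `1` where
all components are. -/
lemma one_sub_two_mul_sum_le_mul_prod_sq {k : ℕ} (a : Fin k → ℝ) (h0 : ∀ j, 0 ≤ a j)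
    (h1 : ∀ j, a j ≤ 1) (i : Fin k) :
    1 - 2 * ∑ j, (1 - a j) ≤ a i * ∏ j ∈ Finset.univ.erase i, a j ^ 2 := by
  have h2 : 1 - ∑ j, (1 - a j ^ 2) ≤ ∏ j, a j ^ 2 :=
    one_sub_sum_one_sub_le_prod _ _ (fun j _ => sq_nonneg _) fun j _ => pow_le_one₀ (h0 j) (h1 j)
  have h3 : ∑ j, (1 - a j ^ 2) ≤ 2 * ∑ j, (1 - a j) := by
    rw [Finset.mul_sum]
    exact Finset.sum_le_sum fun j _ => by nlinarith [sq_nonneg (1 - a j)]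
  have h4 : ∏ j, a j ^ 2 ≤ a i * ∏ j ∈ Finset.univ.erase i, a j ^ 2 := by
    rw [← Finset.mul_prod_erase _ _ (Finset.mem_univ i)]
    refine mul_le_mul_of_nonneg_right ?_ (Finset.prod_nonneg fun j _ => sq_nonneg _)
    nlinarith [h0 i, h1 i]
  linarith

/-- Finitely many nondecreasing positive sequences whose product grows more slowly than `a ^ n`
have arbitrarily late common steps at which none of them grows by more than a factor `a`: the
growth factor of each is at most that of the product. -/
lemma exists_common_slow_step {k : ℕ} (s : Fin k → ℕ → ℝ) (hmono : ∀ i, Monotone (s i)) {n₀ : ℕ}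
    (hpos : ∀ i, 0 < s i n₀) {A q a : ℝ} (hq : 0 < q) (ha : q ^ k < a)
    (hgrowth : ∀ i n, s i n ≤ A * q ^ n) :
    ∃ n, n₀ ≤ n ∧ ∀ i, s i (n + 1) ≤ a * s i n := by
  by_contra! hcon
  have hposn : ∀ i n, n₀ ≤ n → 0 < s i n := fun i n hn => (hpos i).trans_le (hmono i hn)
  have ha0 : 0 < a := (pow_pos hq k).trans ha
  have step : ∀ n, n₀ ≤ n → a * ∏ i, s i n ≤ ∏ i, s i (n + 1) := by
    intro n hn
    obtain ⟨i, hi⟩ := hcon n hn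
    rw [← Finset.mul_prod_erase _ _ (Finset.mem_univ i),
      ← Finset.mul_prod_erase _ (fun i => s i (n + 1)) (Finset.mem_univ i), ← mul_assoc]
    refine mul_le_mul hi.le (Finset.prod_le_prod (fun j _ => (hposn j n hn).le)
      fun j _ => hmono j n.le_succ) (Finset.prod_nonneg fun j _ => (hposn j n hn).le)
      (hposn i _ (by omega)).le
  have lower : ∀ m, a ^ m * ∏ i, s i n₀ ≤ ∏ i, s i (n₀ + m) := by
    intro m
    induction m with
    | zero => simp
    | succ m ih =>
      have h1 := step (n₀ + m) (by omega)
      have h2 := mul_le_mul_of_nonneg_left ih ha0.le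
      rw [pow_succ']
      rw [← add_assoc]
      linarith
  have upper : ∀ n, n₀ ≤ n → ∏ i, s i n ≤ A ^ k * (q ^ k) ^ n := by
    intro n hn
    calc ∏ i, s i n ≤ ∏ _i : Fin k, A * q ^ n :=
          Finset.prod_le_prod (fun j _ => (hposn j n hn).le) fun j _ => hgrowth j n
      _ = A ^ k * (q ^ k) ^ n := by
          rw [Finset.prod_const, Finset.card_univ, Fintype.card_fin, mul_pow, pow_right_comm]
  have hP : 0 < ∏ i, s i n₀ := Finset.prod_pos fun i _ => hpos i
  have hqk : 0 < q ^ k := pow_pos hq k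
  obtain ⟨m, hm⟩ := ((tendsto_pow_atTop_atTop_of_one_lt ((one_lt_div hqk).2 ha)).eventually_gt_atTop
    (A ^ k * (q ^ k) ^ n₀ / ∏ i, s i n₀)).exists
  have h1 := (lower m).trans (upper (n₀ + m) (by omega))
  rw [div_lt_iff₀ hP, div_pow, div_mul_eq_mul_div, lt_div_iff₀ (pow_pos hqk m)] at hm
  rw [pow_add (q ^ k), ← mul_assoc] at h1
  linarith

/-! ### The estimate at one scale -/

section Scale

variable {N : ℕ}

/-- The potential of size `R` around the origin is dominated by the kernel of size `3 * R` around
any point of the ball of radius `R`: that kernel is `1` on the support of the potential. -/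
lemma potential_le_bump {x z : EuclideanSpace ℝ (Fin N)} {R : ℝ} (hR : 0 < R) (hx : ‖x‖ ≤ R) :
    potential 0 R z ≤ bump x (3 * R) z := by
  rcases le_or_gt (2 * R) ‖z‖ with h | h
  · rw [potential_eq_zero hR (by simpa using h)]
    exact cutoff_nonneg _
  · have := norm_sub_le z x
    rw [bump_eq_one (by positivity) (by linarith)]
    exact cutoffPrimitive_le_one (by positivity)

lemma integral_bump (x : EuclideanSpace ℝ (Fin N)) {r : ℝ} (hr : 0 < r) :
    ∫ z, bump x r z = r ^ N * ∫ y : EuclideanSpace ℝ (Fin N), bump 0 1 y := by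
  have h1 := integral_comp_add_smul (bump x r) x hr
  have h2 : ∀ y, bump x r (x + r • y) = bump 0 1 y := fun y => by
    simpa using bump_add_smul x y hr 1
  simp_rw [h2] at h1
  rw [h1]
  field_simp

lemma integral_potential (x : EuclideanSpace ℝ (Fin N)) {r : ℝ} (hr : 0 < r) :
    ∫ z, potential x r z = r ^ N * ∫ y : EuclideanSpace ℝ (Fin N), potential 0 1 y := by
  have h1 := integral_comp_add_smul (potential x r) x hr
  have h2 : ∀ y, potential x r (x + r • y) = potential 0 1 y := fun y => by
    simpa using potential_add_smul x y hr 1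
  simp_rw [h2] at h1
  rw [h1]
  field_simp

/-- If a subharmonic function almost attains its upper bound `T` over a large ball at a point `x`
of the concentric small ball, then it is close to `T` on average over the small ball. -/
lemma integral_sub_mul_potential_le {u f : EuclideanSpace ℝ (Fin N) → ℝ} (hu : Continuous u)
    (h : IsWeakSolutionLaplace u f) (hf : ∀ z, 0 ≤ f z) {R T : ℝ} (hR : 0 < R)
    (hT : ∀ z, ‖z‖ ≤ 7 * R → u z ≤ T) {x : EuclideanSpace ℝ (Fin N)} (hx : ‖x‖ ≤ R) :
    ∫ z, (T - u z) * potential 0 R z ≤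
      (3 * R) ^ N * ((T - u x) * ∫ y : EuclideanSpace ℝ (Fin N), bump 0 1 y) := by
  have h3 : 0 < 3 * R := by positivity
  have hb : IsTestFunction (bump x (3 * R)) := ⟨bump_contDiff _ _, bump_hasCompactSupport _ h3⟩
  have hTu : Continuous fun z => T - u z := continuous_const.sub hu
  calc ∫ z, (T - u z) * potential 0 R z ≤ ∫ z, (T - u z) * bump x (3 * R) z := by
        refine integral_mono ((potential_isTestFunction 0 hR).integrable_mul hTu.locallyIntegrable)
          (hb.integrable_mul hTu.locallyIntegrable) fun z => ?_
        -- the kernel lives in the ball of radius `6 * R` around `x`, where `u ≤ T`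
        rcases le_or_gt ‖z‖ (7 * R) with hz | hz
        · exact mul_le_mul_of_nonneg_left (potential_le_bump hR hx) (sub_nonneg.2 (hT z hz))
        · have := norm_sub_norm_le z x
          simp only
          rw [potential_eq_zero hR (by rw [sub_zero]; linarith), bump_eq_zero h3 (by linarith)]
    _ = T * (∫ z, bump x (3 * R) z) - ∫ z, u z * bump x (3 * R) z := by
        simp_rw [sub_mul]
        rw [integral_sub (hb.integrable_mul continuous_const.locallyIntegrable)
          (hb.integrable_mul hu.locallyIntegrable), integral_const_mul]
    _ ≤ _ := by
        have h1 := mul_integral_bump_le_bumpMean hu h hf x h3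
        rw [bumpMean_eq u x h3, inv_mul_eq_div, le_div_iff₀ (by positivity)] at h1
        rw [integral_bump x h3]
        linarith

/-- Upper bound for the Laplacian of a function with values in `[0, T]`, tested against the
potential: the Laplacian of the potential is `O(R⁻²)` and lives in a ball of radius `2 * R`. -/
lemma exists_integral_mul_potential_le (N : ℕ) : ∃ H : ℝ, 0 ≤ H ∧
    ∀ (u f : EuclideanSpace ℝ (Fin N) → ℝ), Continuous u → IsWeakSolutionLaplace u f →
      (∀ z, 0 ≤ u z) → ∀ R T : ℝ, 0 < R → (∀ z, ‖z‖ ≤ 7 * R → u z ≤ T) →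
        ∫ z, f z * potential 0 R z ≤ H * T * R ^ N * (R ^ 2)⁻¹ := by
  obtain ⟨H, hH0, hH⟩ := exists_abs_euclideanLaplacian_potential_le N
  refine ⟨H * (2 ^ N * volume.real (Metric.ball (0 : EuclideanSpace ℝ (Fin N)) 1)),
    by positivity, fun u f hu h hu0 R T hR hT => ?_⟩
  rw [← h.integral_mul_euclideanLaplacian hu (potential_isTestFunction 0 hR),
    ← setIntegral_eq_integral_of_forall_compl_eq_zero (s := Metric.closedBall 0 (2 * R))]
  · refine (Real.le_norm_self _).trans ((norm_setIntegral_le_of_norm_le_const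
      (C := T * (H * (R ^ 2)⁻¹)) measure_closedBall_lt_top fun z hz => ?_).trans (le_of_eq ?_))
    · rw [mem_closedBall_zero_iff] at hz
      have hz' := hT z (by linarith)
      rw [norm_mul, Real.norm_eq_abs, Real.norm_eq_abs, abs_of_nonneg (hu0 z)]
      exact mul_le_mul hz' (hH 0 z R hR) (abs_nonneg _) ((hu0 z).trans hz')
    · rw [Measure.addHaar_real_closedBall _ _ (by positivity)]
      simp only [finrank_euclideanSpace, Fintype.card_fin, mul_pow]
      ring
  · intro z hz
    rw [mem_closedBall_zero_iff, not_le] at hz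
    rw [euclideanLaplacian_potential_eq_zero hR (by rw [sub_zero]; exact hz.le), mul_zero]

/-- If, at some scale `R`, every component of a solution almost attains in the ball of radius `R`
its bound `T i` over the ball of radius `7 R`, then all components are close to their bounds on
most of the small ball, and the equation bounds the product of the `T i` by `O(R⁻²)`. -/
lemma exists_prod_mul_sq_le (N : ℕ) {k : ℕ} (hk : 0 < k) : ∃ ε : ℝ, 0 < ε ∧ ∃ C₀ : ℝ,
    ∀ (M : ℝ) (u : Fin k → EuclideanSpace ℝ (Fin N) → ℝ), 0 < M → (∀ i, Continuous (u i)) →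
      (∀ i x, 0 ≤ u i x) →
      (∀ i, IsWeakSolutionLaplace (u i)
        (fun x => M * u i x * ∏ j ∈ Finset.univ.erase i, u j x ^ 2)) →
      ∀ (R : ℝ) (T : Fin k → ℝ), 0 < R → (∀ i, 0 < T i) →
        (∀ i z, ‖z‖ ≤ 7 * R → u i z ≤ T i) →
        (∀ i, ∃ x, ‖x‖ ≤ R ∧ T i ≤ (1 + ε) * u i x) →
        ∀ i, M * (∏ j ∈ Finset.univ.erase i, T j ^ 2) * R ^ 2 ≤ C₀ := by
  obtain ⟨H, hH0, hH⟩ := exists_integral_mul_potential_le N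
  have hI : 0 < ∫ y : EuclideanSpace ℝ (Fin N), bump 0 1 y := integral_bump_pos
  have hJ : 0 < ∫ y : EuclideanSpace ℝ (Fin N), potential 0 1 y := integral_potential_pos
  set I := ∫ y : EuclideanSpace ℝ (Fin N), bump 0 1 y
  set J := ∫ y : EuclideanSpace ℝ (Fin N), potential 0 1 y with hJdef
  have hk' : (0 : ℝ) < k := Nat.cast_pos.2 hk
  -- with this `ε`, the total defect of the `k` components is at most half the mass of the potential
  refine ⟨J / (4 * k * 3 ^ N * I), by positivity, 2 * H / J,
    fun M u hM hu hu0 hsol R T hR hT0 hT hx i => ?_⟩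
  set ε := J / (4 * k * 3 ^ N * I) with hε
  set Q := ∏ j ∈ Finset.univ.erase i, T j ^ 2 with hQ
  have hQ0 : 0 < Q := Finset.prod_pos fun j _ => pow_pos (hT0 j) 2
  have hψ := potential_isTestFunction (0 : EuclideanSpace ℝ (Fin N)) hR
  have hdef : ∀ j, ∫ z, (1 - u j z / T j) * potential 0 R z ≤ (3 * R) ^ N * (ε * I) := by
    intro j
    obtain ⟨x, hxR, hxT⟩ := hx j
    have h1 := integral_sub_mul_potential_le (hu j) (hsol j) (fun z => by
      have := hu0 j z
      positivity) hR (hT j) hxR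
    have h2 : ∀ z, (1 - u j z / T j) * potential 0 R z
        = (T j)⁻¹ * ((T j - u j z) * potential 0 R z) := fun z => by
      have := (hT0 j).ne'
      field_simp
    simp_rw [h2]
    rw [integral_const_mul, inv_mul_le_iff₀ (hT0 j)]
    refine h1.trans ?_
    have h3 : T j - u j x ≤ ε * T j := by
      have h4 : ε * u j x ≤ ε * T j :=
        mul_le_mul_of_nonneg_left (hT j x (by linarith)) (by positivity)
      linarith
    calc (3 * R) ^ N * ((T j - u j x) * I) ≤ (3 * R) ^ N * ((ε * T j) * I) := by gcongr
      _ = T j * ((3 * R) ^ N * (ε * I)) := by ring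
  have hlow : M * T i * Q * (R ^ N * J - 2 * ∑ _j : Fin k, (3 * R) ^ N * (ε * I)) ≤
      ∫ z, (M * u i z * ∏ j ∈ Finset.univ.erase i, u j z ^ 2) * potential 0 R z := by
    have hint : ∀ j, Integrable fun z => (1 - u j z / T j) * potential 0 R z := fun j =>
      hψ.integrable_mul (Continuous.locallyIntegrable (by have := hu j; fun_prop))
    have hint1 : Integrable fun z : EuclideanSpace ℝ (Fin N) => potential 0 R z :=
      hψ.1.continuous.integrable_of_hasCompactSupport hψ.2
    calc M * T i * Q * (R ^ N * J - 2 * ∑ _j : Fin k, (3 * R) ^ N * (ε * I))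
        ≤ M * T i * Q * (R ^ N * J - 2 * ∑ j, ∫ z, (1 - u j z / T j) * potential 0 R z) := by
          have := hT0 i
          gcongr with j
          exact hdef j
      _ = ∫ z, M * T i * Q * (potential 0 R z
            - 2 * ∑ j, (1 - u j z / T j) * potential 0 R z) := by
          rw [integral_const_mul, integral_sub hint1
            ((integrable_finsetSum _ fun j _ => hint j).const_mul 2), integral_const_mul,
            integral_finsetSum _ fun j _ => hint j, integral_potential 0 hR]
      _ ≤ _ := by
          refine integral_mono ((hint1.sub
            ((integrable_finsetSum _ fun j _ => hint j).const_mul 2)).const_mul _)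
            (hψ.integrable_mul (Continuous.locallyIntegrable (by
              have := hu
              fun_prop))) fun z => ?_
          rcases le_or_gt (2 * R) ‖z‖ with hz | hz
          · simp [potential_eq_zero hR (by rw [sub_zero]; exact hz)]
          · have h1 := one_sub_two_mul_sum_le_mul_prod_sq (fun j => u j z / T j)
              (fun j => div_nonneg (hu0 j z) (hT0 j).le)
              (fun j => (div_le_one (hT0 j)).2 (hT j z (by linarith))) i
            have h2 : M * u i z * ∏ j ∈ Finset.univ.erase i, u j z ^ 2 =
                M * T i * Q * (u i z / T i * ∏ j ∈ Finset.univ.erase i, (u j z / T j) ^ 2) := by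
              simp_rw [div_pow]
              rw [Finset.prod_div_distrib, ← hQ]
              have := (hT0 i).ne'
              field_simp
            have h3 : M * T i * Q * (1 - 2 * ∑ j, (1 - u j z / T j)) ≤
                M * u i z * ∏ j ∈ Finset.univ.erase i, u j z ^ 2 := by
              rw [h2]
              have := hT0 i
              gcongr
            have h4 := mul_le_mul_of_nonneg_right h3 (cutoffPrimitive_nonneg (‖z - 0‖ ^ 2 / R ^ 2))
            refine le_trans (le_of_eq ?_) h4
            rw [← Finset.sum_mul, potential]
            ring
  have hup := hH (u i) _ (hu i) (hsol i) (hu0 i) R (T i) hR (hT i)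
  have hfin := hlow.trans hup
  have hhalf : R ^ N * J - 2 * ∑ _j : Fin k, (3 * R) ^ N * (ε * I) = R ^ N * (J / 2) := by
    rw [Finset.sum_const, Finset.card_univ, Fintype.card_fin, nsmul_eq_mul, hε, mul_pow]
    field_simp
    ring
  rw [hhalf] at hfin
  have hpos : 0 < T i * R ^ N := mul_pos (hT0 i) (by positivity)
  have h5 : M * Q * (J / 2) ≤ H * (R ^ 2)⁻¹ := by
    refine le_of_mul_le_mul_left ?_ hpos
    calc T i * R ^ N * (M * Q * (J / 2)) = M * T i * Q * (R ^ N * (J / 2)) := by ring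
      _ ≤ _ := hfin
      _ = _ := by ring
  rw [← div_eq_mul_inv, le_div_iff₀ (by positivity)] at h5
  rw [le_div_iff₀ hJ]
  linarith

end Scale

section Main

variable {N : ℕ}

/-! ### Suprema over balls and the conclusion -/

/-- The supremum of `u` over the closed ball of radius `R` around the origin. -/
noncomputable def ballSup (u : EuclideanSpace ℝ (Fin N) → ℝ) (R : ℝ) : ℝ :=
  sSup (u '' Metric.closedBall 0 R)

lemma le_ballSup {u : EuclideanSpace ℝ (Fin N) → ℝ} (hu : Continuous u) {R : ℝ}
    {x : EuclideanSpace ℝ (Fin N)} (hx : ‖x‖ ≤ R) : u x ≤ ballSup u R :=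
  le_csSup ((isCompact_closedBall 0 R).bddAbove_image hu.continuousOn)
    ⟨x, mem_closedBall_zero_iff.2 hx, rfl⟩

lemma exists_eq_ballSup {u : EuclideanSpace ℝ (Fin N) → ℝ} (hu : Continuous u) {R : ℝ}
    (hR : 0 ≤ R) : ∃ x, ‖x‖ ≤ R ∧ u x = ballSup u R := by
  obtain ⟨x, hx, h⟩ := (isCompact_closedBall (0 : EuclideanSpace ℝ (Fin N)) R).exists_sSup_image_eq
    (Metric.nonempty_closedBall.2 hR) hu.continuousOn
  exact ⟨x, mem_closedBall_zero_iff.1 hx, h.symm⟩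

lemma ballSup_mono {u : EuclideanSpace ℝ (Fin N) → ℝ} (hu : Continuous u) {R R' : ℝ}
    (hR : 0 ≤ R) (h : R ≤ R') : ballSup u R ≤ ballSup u R' := by
  obtain ⟨x, hx, he⟩ := exists_eq_ballSup hu hR
  exact he ▸ le_ballSup hu (hx.trans h)

/-- A growth bound by `1 + ‖x‖ ^ α`, where `α` may be negative, gives one by `(1 + ‖x‖) ^ β` with
`β = max α 0`. -/
lemma exists_growth_bound {u : EuclideanSpace ℝ (Fin N) → ℝ} (hu : Continuous u)
    {C α : ℝ} (h : ∀ x, u x ≤ C * (1 + ‖x‖ ^ α)) :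
    ∃ A, 0 ≤ A ∧ ∀ x, u x ≤ A * (1 + ‖x‖) ^ max α 0 := by
  refine ⟨max (ballSup u 1) (2 * |C|), le_max_of_le_right (by positivity), fun x => ?_⟩
  have hβ : (0 : ℝ) ≤ max α 0 := le_max_right _ _
  have hone : 1 ≤ (1 + ‖x‖) ^ max α 0 := Real.one_le_rpow (by linarith [norm_nonneg x]) hβ
  have hA : 0 ≤ max (ballSup u 1) (2 * |C|) := le_max_of_le_right (by positivity)
  rcases le_total ‖x‖ 1 with hx | hx
  · exact ((le_ballSup hu hx).trans (le_max_left _ _)).trans (le_mul_of_one_le_right hA hone)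
  · have h1 : ‖x‖ ^ α ≤ (1 + ‖x‖) ^ max α 0 :=
      (Real.rpow_le_rpow_of_exponent_le hx (le_max_left _ _)).trans
        (Real.rpow_le_rpow (by positivity) (by linarith) hβ)
    calc u x ≤ C * (1 + ‖x‖ ^ α) := h x
      _ ≤ |C| * (1 + ‖x‖ ^ α) := by gcongr; exact le_abs_self C
      _ ≤ |C| * (2 * (1 + ‖x‖) ^ max α 0) := by gcongr; linarith
      _ = 2 * |C| * (1 + ‖x‖) ^ max α 0 := by ring
      _ ≤ _ := by gcongr; exact le_max_right _ _

lemma exists_exponent (k : ℕ) {ε : ℝ} (hε : 0 < ε) :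
    ∃ ν : ℝ, 0 < ν ∧ ν < 1 ∧ ((7 : ℝ) ^ ν) ^ k < 1 + ε := by
  have hc : Continuous fun ν : ℝ => ((7 : ℝ) ^ ν) ^ k :=
    (Real.continuous_const_rpow (by norm_num)).pow k
  have h1 : ∀ᶠ ν in nhdsWithin (0 : ℝ) (Set.Ioi 0), ((7 : ℝ) ^ ν) ^ k < 1 + ε :=
    (hc.tendsto 0).mono_left nhdsWithin_le_nhds |>.eventually_lt_const (by simpa using hε)
  obtain ⟨ν, h, h0, h1⟩ := (h1.and (Ioo_mem_nhdsGT one_pos)).exists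
  exact ⟨ν, h0, h1, h⟩

/-- If `(7 ^ β) ^ k` is close enough to `1`, some component of a nonnegative solution growing at
most like `(1 + ‖x‖) ^ β` vanishes. -/
lemma exists_component_eq_zero {k : ℕ} (hk : 0 < k) {ε C₀ β M A : ℝ}
    {u : Fin k → EuclideanSpace ℝ (Fin N) → ℝ} (hβ : 0 ≤ β) (hβε : ((7 : ℝ) ^ β) ^ k < 1 + ε)
    (hM : 0 < M) (hA : 0 ≤ A) (hu : ∀ i, Continuous (u i)) (hu0 : ∀ i x, 0 ≤ u i x)
    (hscale : ∀ (R : ℝ) (T : Fin k → ℝ), 0 < R → (∀ i, 0 < T i) →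
      (∀ i z, ‖z‖ ≤ 7 * R → u i z ≤ T i) → (∀ i, ∃ x, ‖x‖ ≤ R ∧ T i ≤ (1 + ε) * u i x) →
      ∀ i, M * (∏ j ∈ Finset.univ.erase i, T j ^ 2) * R ^ 2 ≤ C₀)
    (hgrowth : ∀ i x, u i x ≤ A * (1 + ‖x‖) ^ β) : ∃ i, ∀ x, u i x = 0 := by
  by_contra! hne
  choose p hp using hne
  have hp0 : ∀ i, 0 < u i (p i) := fun i => lt_of_le_of_ne (hu0 i _) (hp i).symm
  let i₀ : Fin k := ⟨0, hk⟩
  set s : Fin k → ℕ → ℝ := fun i n => ballSup (u i) (7 ^ n) with hs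
  have hmono : ∀ i, Monotone (s i) := fun i m n hmn =>
    ballSup_mono (hu i) (by positivity) (pow_le_pow_right₀ (by norm_num) hmn)
  have h7 : Filter.Tendsto (fun n : ℕ => (7 : ℝ) ^ n) Filter.atTop Filter.atTop :=
    tendsto_pow_atTop_atTop_of_one_lt (by norm_num)
  obtain ⟨n₁, hn₁⟩ : ∃ n₁, ∀ i, 0 < s i n₁ := by
    obtain ⟨n, hn⟩ := (Filter.eventually_all.2
      fun i => h7.eventually_ge_atTop ‖p i‖).exists
    exact ⟨n, fun i => (hp0 i).trans_le (le_ballSup (hu i) (hn i))⟩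
  -- the quantity bounded at every good scale, estimated from below by the suprema at step `n₁`
  set c := M * ∏ j ∈ Finset.univ.erase i₀, s j n₁ ^ 2 with hc
  have hc0 : 0 < c := mul_pos hM (Finset.prod_pos fun j _ => pow_pos (hn₁ j) 2)
  obtain ⟨n₂, hn₂⟩ := (h7.eventually_gt_atTop (max 1 (C₀ / c))).exists
  have hsg : ∀ i n, s i n ≤ A * 2 ^ β * ((7 : ℝ) ^ β) ^ n := by
    intro i n
    obtain ⟨x, hx, he⟩ := exists_eq_ballSup (hu i) (R := 7 ^ n) (by positivity)
    have h1n : (1 : ℝ) ≤ 7 ^ n := one_le_pow₀ (by norm_num)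
    calc s i n = u i x := he.symm
      _ ≤ A * (1 + ‖x‖) ^ β := hgrowth i x
      _ ≤ A * (2 * 7 ^ n) ^ β := by gcongr; linarith
      _ = A * 2 ^ β * ((7 : ℝ) ^ β) ^ n := by
        rw [Real.mul_rpow (by norm_num) (by positivity), ← Real.rpow_natCast, ← Real.rpow_natCast,
          ← Real.rpow_mul (by norm_num), ← Real.rpow_mul (by norm_num), mul_comm (n : ℝ) β]
        ring
  obtain ⟨n, hn, hslow⟩ := exists_common_slow_step s hmono (n₀ := max n₁ n₂)
    (fun i => (hn₁ i).trans_le (hmono i (le_max_left _ _))) (by positivity) hβε hsg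
  have hn1 : n₁ ≤ n := (le_max_left _ _).trans hn
  have hn2 : n₂ ≤ n := (le_max_right _ _).trans hn
  have h1 := hscale (7 ^ n) (fun i => s i (n + 1)) (by positivity)
    (fun i => (hn₁ i).trans_le (hmono i (by omega)))
    (fun i z hz => le_ballSup (hu i) (by rwa [pow_succ']))
    (fun i => by
      obtain ⟨x, hx, he⟩ := exists_eq_ballSup (hu i) (R := 7 ^ n) (by positivity)
      exact ⟨x, hx, he ▸ hslow i⟩) i₀
  have h2 : c ≤ M * ∏ j ∈ Finset.univ.erase i₀, s j (n + 1) ^ 2 := by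
    rw [hc]
    gcongr with j
    · exact (hn₁ j).le
    · exact hmono j (by omega)
  have h3 : max 1 (C₀ / c) < 7 ^ n :=
    hn₂.trans_le (pow_le_pow_right₀ (by norm_num) hn2)
  have h4 : (7 : ℝ) ^ n ≤ (7 ^ n) ^ 2 := le_self_pow₀ ((le_max_left _ _).trans h3.le) (by norm_num)
  have h5 : C₀ < 7 ^ n * c := (div_lt_iff₀ hc0).1 ((le_max_right _ _).trans_lt h3)
  have h6 : (7 : ℝ) ^ n * c ≤
      M * (∏ j ∈ Finset.univ.erase i₀, s j (n + 1) ^ 2) * (7 ^ n) ^ 2 := by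
    rw [mul_comm]
    gcongr
  linarith

end Main

theorem mainTheorem4 (N k : ℕ) (hN : 2 ≤ N) (hk : 3 ≤ k) :
    ∃ ν : ℝ, 0 < ν ∧ ν < 1 ∧
      ∀ (M : ℝ) (u : Fin k → EuclideanSpace ℝ (Fin N) → ℝ) (C α : ℝ),
        0 < M →
        (∀ i, MemH1Loc (u i)) →
        (∀ i, Continuous (u i)) →
        (∀ i x, 0 ≤ u i x) →
        (∀ i, IsWeakSolutionLaplace (u i)
          (fun x => M * u i x * ∏ j ∈ Finset.univ.erase i, u j x ^ 2)) →
        α < ν →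
        (∀ i x, u i x ≤ C * (1 + ‖x‖ ^ α)) →
        ∃ i, (∀ x, u i x = 0) ∧ ∀ j, j ≠ i → ∃ c : ℝ, ∀ x, u j x = c := by
  obtain ⟨ε, hε, C₀, hscale⟩ := exists_prod_mul_sq_le N (by omega : 0 < k)
  obtain ⟨ν, hν0, hν1, hν⟩ := exists_exponent k hε
  refine ⟨ν, hν0, hν1, fun M u C α hM _ hu hu0 hsol hα hgrowth => ?_⟩
  have hβ0 : (0 : ℝ) ≤ max α 0 := le_max_right _ _
  have hβν : max α 0 < ν := max_lt hα hν0
  choose A hA0 hA using fun i => exists_growth_bound (hu i) (hgrowth i)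
  have hAi : ∀ i x, u i x ≤ (∑ j, A j) * (1 + ‖x‖) ^ max α 0 := fun i x =>
    (hA i x).trans (by
      gcongr
      exact Finset.single_le_sum (fun j _ => hA0 j) (Finset.mem_univ i))
  have hβε : ((7 : ℝ) ^ max α 0) ^ k < 1 + ε := by
    refine lt_of_le_of_lt ?_ hν
    gcongr
    norm_num
  obtain ⟨i, hi⟩ := exists_component_eq_zero (by omega) hβ0 hβε hM
    (Finset.sum_nonneg fun j _ => hA0 j) hu hu0 (hscale M u hM hu hu0 hsol) hAi
  refine ⟨i, hi, fun j hj => ⟨u j 0, ?_⟩⟩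
  -- the factor `u i` makes the right-hand side of the equation for `u j` vanish
  have hzero : (fun x => M * u j x * ∏ l ∈ Finset.univ.erase j, u l x ^ 2) = fun _ => 0 := by
    ext x
    rw [Finset.prod_eq_zero (Finset.mem_erase.2 ⟨hj.symm, Finset.mem_univ i⟩) (by rw [hi x]; simp),
      mul_zero]
  exact eq_zero_value_of_weaklyHarmonic (hu j) (hzero ▸ hsol j) (hA0 j) hβ0 (hβν.trans hν1)
    fun x => by rw [abs_of_nonneg (hu0 j x)]; exact hA j x
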